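/- Let $W_0,W_1,\ldots$ be the numbering of all recursively enumerable (r.e.) subsets of $\mathbb N$ given by a fixed acceptable numbering of the partial recursive functions. A *positive equivalence relation* is an r.e. equivalence relation $\eta$ on $\mathbb N$ with infinitely many equivalence classes. A set is *$\eta$-finite* (*$\eta$-infinite*) if it is the union of finitely many, possibly zero (of infinitely many) $\eta$-equivalence classes, and *$\eta$-closed* if it is one of the two. An *$\eta$-family* is an infinite family of $\eta$-closed sets of the form $\{W_i : i\in S\}$, where $S$ is an r.e. set and $W_i\ne W_j$ for distinct $i,j\in S$. A *text* for $L\subseteq\mathbb N$ is a map $T:\mathbb N\to\mathbb N\cup\{\#\}$ with $\operatorname{range}(T)\setminus\{\#\}=L$; $T[n]$ denotes $T(0),\ldots,T(n-1)$. A *learner* is a recursive function $M:(\mathbb N\cup\{\#\})^*\to\mathbb N\cup\{?\}$, where the hypothesis $e\in\mathbb N$ stands for the $\eta$-closure $[W_e]=\{y : y\mathrel{\eta}x \text{ for some } x\in W_e\}$ of $W_e$ and $?$ stands for no set. Let $F$ be an $\eta$-family. * $M$ *explanatorily learns* $F$ if for every $L\in F$ and every text $T$ for $L$ there is an $n$ such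 that $M(T[n])$ is a hypothesis for $L$ and $M(T[j])=M(T[n])$ for all $j\ge n$. * $M$ *confidently learns* $F$ if it explanatorily learns $F$ and, for every text $T$ for any subset of $\mathbb N$, there is an $n$ with $M(T[j])=M(T[n])$ for all $j\ge n$. * $M$ *behaviourally correctly learns* $F$ if for every $L\in F$ and every text $T$ for $L$ there is an $n$ such that $M(T[j])$ is a hypothesis for $L$ for all $j\ge n$. * $M$ *vacillatorily learns* $F$ if it behaviourally correctly learns $F$ and, for every $L\in F$ and every text $T$ for $L$, the set $\{M(T[n]) : n\ge 1\}$ is finite. $F$ is learnable in one of these senses if some learner learns it in that sense. **Theorem.** There is a positive equivalence relation $\vartheta$ with the following properties. 1. $\mathbb N$ is the only $\vartheta$-infinite r.e. set. 2. Every $\vartheta$-family contains an infinite ascending chain $B_0\subsetneq B_1\subsetneq\cdots$ of $\vartheta$-finite sets whose union is $\mathbb N$. Moreover, no $\vartheta$-family is confidently learnable, and every behaviourally correctly learnable $\vartheta$-family consists only of $\vartheta$-finite sets. 3. Every vacillatorily learnable $\vartheta$-family is explanatorily learnable. -/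

import Mathlib

namespace EtaLearning

/-- `W e` is the `e`-th recursively enumerable set: the domain of the `e`-th partial recursive
function in the (acceptable) numbering given by codes of partial recursive functions. -/
def W (e : ℕ) : Set ℕ := {x | ((Denumerable.ofNat Nat.Partrec.Code e).eval x).Dom}

/-- A set of natural numbers is recursively enumerable. -/
def IsRE (A : Set ℕ) : Prop := REPred fun x : ℕ => x ∈ A

/-- A positive equivalence relation: a recursively enumerable equivalence relation on `ℕ` which
has infinitely many equivalence classes. -/
def IsPositive (η : Setoid ℕ) : Prop :=
  REPred (fun p : ℕ × ℕ => η p.1 p.2) ∧ η.classes.Infinite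

/-- A set is `η`-finite if it is a union of finitely many (possibly zero) `η`-classes. -/
def EtaFinite (η : Setoid ℕ) (A : Set ℕ) : Prop :=
  ∃ C : Set (Set ℕ), C ⊆ η.classes ∧ C.Finite ∧ A = ⋃₀ C

/-- A set is `η`-infinite if it is a union of infinitely many `η`-classes. -/
def EtaInfinite (η : Setoid ℕ) (A : Set ℕ) : Prop :=
  ∃ C : Set (Set ℕ), C ⊆ η.classes ∧ C.Infinite ∧ A = ⋃₀ C

/-- A set is `η`-closed if it is `η`-finite or `η`-infinite. -/
def EtaClosed (η : Setoid ℕ) (A : Set ℕ) : Prop :=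
  EtaFinite η A ∨ EtaInfinite η A

/-- The `η`-closure of a set. -/
def etaClosure (η : Setoid ℕ) (A : Set ℕ) : Set ℕ := {y | ∃ x ∈ A, η y x}

/-- A family of sets is one-one r.e. if it is `{W i : i ∈ S}` for some r.e. set `S` on which
different indices give different sets. -/
def OneOneRE (F : Set (Set ℕ)) : Prop :=
  ∃ S : Set ℕ, IsRE S ∧ Set.InjOn W S ∧ F = W '' S

/-- An `η`-family: an infinite one-one r.e. family of `η`-closed sets. -/
def IsEtaFamily (η : Setoid ℕ) (F : Set (Set ℕ)) : Prop :=
  F.Infinite ∧ OneOneRE F ∧ ∀ L ∈ F, EtaClosed η L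

/-- `T` is a text for `L`; the value `none` is the pause symbol. -/
def IsText (T : ℕ → Option ℕ) (L : Set ℕ) : Prop := {x | ∃ n, T n = some x} = L

/-- The initial segment `T 0, …, T (n - 1)` of a text. -/
def initSeg (T : ℕ → Option ℕ) (n : ℕ) : List (Option ℕ) := (List.range n).map T

/-- A learner maps finite sequences of numbers and pauses to hypotheses, where the value `none`
(written `?` in the literature) means that no conjecture is made. Learners have to be
recursive, which is part of the learning criteria below. -/
abbrev Learner := List (Option ℕ) → Option ℕ

/-- The hypothesis `h` is an index of `L` in the hypothesis space that consists of the
`η`-closures of `W 0, W 1, …`; the value `none` is not an index of any set. -/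
def IsIndexOf (η : Setoid ℕ) (h : Option ℕ) (L : Set ℕ) : Prop :=
  ∃ e : ℕ, h = some e ∧ etaClosure η (W e) = L

/-- `M` explanatorily learns `F`. -/
def ExLearns (η : Setoid ℕ) (M : Learner) (F : Set (Set ℕ)) : Prop :=
  ∀ L ∈ F, ∀ T, IsText T L →
    ∃ n, IsIndexOf η (M (initSeg T n)) L ∧ ∀ j, n ≤ j → M (initSeg T j) = M (initSeg T n)

/-- `M` behaviourally correctly learns `F`. -/
def BCLearns (η : Setoid ℕ) (M : Learner) (F : Set (Set ℕ)) : Prop :=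
  ∀ L ∈ F, ∀ T, IsText T L → ∃ n, ∀ j, n ≤ j → IsIndexOf η (M (initSeg T j)) L

/-- `M` confidently learns `F`: it explanatorily learns `F` and converges on every text for
every set of natural numbers. -/
def ConfLearns (η : Setoid ℕ) (M : Learner) (F : Set (Set ℕ)) : Prop :=
  ExLearns η M F ∧
    ∀ (L : Set ℕ) (T : ℕ → Option ℕ), IsText T L →
      ∃ n, ∀ j, n ≤ j → M (initSeg T j) = M (initSeg T n)

/-- `M` vacillatorily learns `F`: it behaviourally correctly learns `F` and issues only finitely
many different hypotheses on every text for a member of `F`. -/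
def VacLearns (η : Setoid ℕ) (M : Learner) (F : Set (Set ℕ)) : Prop :=
  BCLearns η M F ∧
    ∀ L ∈ F, ∀ T, IsText T L → {h | ∃ n, 1 ≤ n ∧ M (initSeg T n) = h}.Finite

def ExLearnable (η : Setoid ℕ) (F : Set (Set ℕ)) : Prop :=
  ∃ M : Learner, Computable M ∧ ExLearns η M F

def BCLearnable (η : Setoid ℕ) (F : Set (Set ℕ)) : Prop :=
  ∃ M : Learner, Computable M ∧ BCLearns η M F

def ConfLearnable (η : Setoid ℕ) (F : Set (Set ℕ)) : Prop :=
  ∃ M : Learner, Computable M ∧ ConfLearns η M F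

def VacLearnable (η : Setoid ℕ) (F : Set (Set ℕ)) : Prop :=
  ∃ M : Learner, Computable M ∧ VacLearns η M F

end EtaLearning

open Nat.Partrec (Code)
open Nat.Partrec.Code Filter

namespace EtaLearning

/-! ### The stage construction -/

/-! The relation is the limit of a merging process. Each class is represented by its least element.
A representative `b` with `m` smaller representatives may be merged into a smaller one, `a`, when
one of the first `width m` sets of a uniform list of all r.e. sets has met the class of `b` but not
that of `a`. For fixed `m` only finitely many requests of this kind arise once the smaller
representatives have settled, so infinitely many classes survive (`infinite_roots`). In the limit
each of the first `width m` sets that meets the class of the representative of index `m` also meets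
all earlier classes (`key`).

Thus a saturated r.e. set is downward closed among representatives of large index, and a ϑ-infinite
one is everything. In a one-one family, `width` grows fast enough for `2 ^ m + 2` members to obey
`key` at all indices from a large `m` on. If every member other than `ℕ` missed one of the first `k
≤ m` representatives, these members would be told apart by their traces on the first `m`
representatives, of which there are only `2 ^ m`. Hence some member other than `ℕ` contains any
prescribed initial segment of representatives (`IsEtaFamily.exists_mem_of_index_lt`), which gives
the chains.

A chain lets one build a text for `ℕ` on which a behaviourally correct learner conjectures
arbitrarily late members of the chain; this excludes confident learning and excludes `ℕ` as a
member. A vacillating learner uses boundedly many indices, so from a bound found in the limit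
onwards the representatives in `L` are downward closed. Cutting the data at the first missing one
gives a finite list that converges and generates `L`. -/

/-- `x` is enumerated into the `q`-th set of the uniformly r.e. list used in the construction
within `s` steps. -/
def EnumAt (q s x : ℕ) : Prop :=
  (evaln s (Denumerable.ofNat Code q.unpair.1) (Nat.pair q.unpair.2 x)).isSome = true

instance (q s x : ℕ) : Decidable (EnumAt q s x) := inferInstanceAs (Decidable (_ = true))

/-- The `q`-th set of the uniformly r.e. list used in the construction. -/
def U (q : ℕ) : Set ℕ := {x | ∃ s, EnumAt q s x}

/-- The number of sets which may destroy the `m`-th representative. -/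
def width (m : ℕ) : ℕ := (2 ^ m + 2) * (2 ^ m + 2)

/-- The representative of `x` after the merges in `H`, where `(a, b)` sends the class
of `b` to `a`. -/
def rep (H : List (ℕ × ℕ)) (x : ℕ) : ℕ := H.foldr (fun p v => if v = p.2 then p.1 else v) x

/-- The number of representatives below `x`. -/
def idx (H : List (ℕ × ℕ)) (x : ℕ) : ℕ := Nat.count (fun y => rep H y = y) x

/-- Some element with representative `v` is enumerated into the `q`-th set by stage `s`. -/
def Hits (q s : ℕ) (H : List (ℕ × ℕ)) (v : ℕ) : Prop := ∃ u < s, EnumAt q s u ∧ rep H u = v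

instance (q s : ℕ) (H : List (ℕ × ℕ)) (v : ℕ) : Decidable (Hits q s H v) :=
  inferInstanceAs (Decidable (∃ u < s, _))

/-- The pair coded by `c` may be merged at stage `s`. -/
def Enabled (s : ℕ) (H : List (ℕ × ℕ)) (c : ℕ) : Prop :=
  (c.unpair.1 < c.unpair.2 ∧ rep H c.unpair.1 = c.unpair.1 ∧ rep H c.unpair.2 = c.unpair.2) ∧
    ∃ q < width (idx H c.unpair.2), Hits q s H c.unpair.2 ∧ ¬ Hits q s H c.unpair.1

instance (s : ℕ) (H : List (ℕ × ℕ)) (c : ℕ) : Decidable (Enabled s H c) :=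
  inferInstanceAs (Decidable (_ ∧ ∃ q < width _, _))

/-- The merge performed at stage `s`; the merge `(0, 0)` is void. -/
def act (s : ℕ) (H : List (ℕ × ℕ)) : ℕ × ℕ :=
  -- `findIdx` returns `s` when no code below `s` is enabled; the default `(0, 0)` then sends 0 to
  -- itself.
  if (List.range s).findIdx (fun c => decide (Enabled s H c)) < s then
    ((List.range s).findIdx (fun c => decide (Enabled s H c))).unpair else (0, 0)

/-- The merges performed before stage `s`, the latest one first. -/
def hist : ℕ → List (ℕ × ℕ)
  | 0 => []
  | s + 1 => act s (hist s) :: hist s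

/-- The representative of `x` at stage `s`. -/
def r (s x : ℕ) : ℕ := rep (hist s) x

/-! ### Primitive recursiveness of the construction -/

theorem primrec_rep : Primrec₂ rep := by
  refine (Primrec.list_foldr (f := fun p : List (ℕ × ℕ) × ℕ => p.1) (g := fun p => p.2)
    (h := fun _ q => if q.2 = q.1.2 then q.1.1 else q.2) Primrec.fst Primrec.snd ?_).to₂
  refine Primrec.ite ?_ ?_ ?_
  · exact Primrec.eq.comp (Primrec.snd.comp Primrec.snd)
      (Primrec.snd.comp (Primrec.fst.comp Primrec.snd))
  · exact Primrec.fst.comp (Primrec.fst.comp Primrec.snd)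
  · exact Primrec.snd.comp Primrec.snd

theorem primrec_width : Primrec width := by
  have h2 : Primrec (fun m : ℕ => 2 ^ m) := by
    refine (Primrec.nat_rec₁ (f := fun _ v => v + v) 1 ?_).of_eq ?_
    · exact Primrec.nat_add.comp Primrec.snd Primrec.snd
    · intro n
      induction n with
      | zero => rfl
      | succ n ih => rw [pow_succ, ← ih]; simp only []; ring
  have h3 : Primrec (fun m : ℕ => 2 ^ m + 2) := Primrec.nat_add.comp h2 (Primrec.const 2)
  exact Primrec.nat_mul.comp h3 h3

theorem primrec_idx : Primrec₂ idx := by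
  have h1 : PrimrecRel fun (y : ℕ) (H : List (ℕ × ℕ)) => rep H y = y :=
    Primrec.eq.comp (primrec_rep.comp Primrec.snd Primrec.fst) Primrec.fst
  have h2 : Primrec₂ fun (H : List (ℕ × ℕ)) (n : ℕ) =>
      Nat.rec (motive := fun _ => ℕ) 0 (fun y v => if rep H y = y then v + 1 else v) n := by
    refine Primrec.nat_rec (f := fun _ : List (ℕ × ℕ) => 0)
      (g := fun H p => if rep H p.1 = p.1 then p.2 + 1 else p.2) (Primrec.const 0) ?_
    refine Primrec.ite ?_ ?_ ?_
    · exact h1.comp (Primrec.fst.comp Primrec.snd) Primrec.fst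
    · exact Primrec.succ.comp (Primrec.snd.comp Primrec.snd)
    · exact Primrec.snd.comp Primrec.snd
  refine h2.of_eq fun H n => ?_
  induction n with
  | zero => simp [idx]
  | succ n ih =>
    simp only [idx, Nat.count_succ] at ih ⊢
    rw [ih]; split_ifs <;> rfl

theorem primrec_enumAt :
    PrimrecPred fun p : ℕ × ℕ × ℕ => EnumAt p.1 p.2.1 p.2.2 := by
  have h : Primrec fun p : ℕ × ℕ × ℕ =>
      (evaln p.2.1 (Denumerable.ofNat Code p.1.unpair.1) (Nat.pair p.1.unpair.2 p.2.2)).isSome := by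
    refine Primrec.option_isSome.comp (primrec_evaln.comp (Primrec.pair (Primrec.pair ?_ ?_) ?_))
    · exact Primrec.fst.comp Primrec.snd
    · exact (Primrec.ofNat Code).comp (Primrec.fst.comp (Primrec.unpair.comp Primrec.fst))
    · exact Primrec₂.natPair.comp (Primrec.snd.comp (Primrec.unpair.comp Primrec.fst))
        (Primrec.snd.comp Primrec.snd)
  exact Primrec.eq.comp h (Primrec.const true)

theorem primrec_hits :
    PrimrecPred fun p : (ℕ × ℕ) × List (ℕ × ℕ) × ℕ => Hits p.1.1 p.1.2 p.2.1 p.2.2 := by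
  have h : PrimrecRel fun (u : ℕ) (p : (ℕ × ℕ) × List (ℕ × ℕ) × ℕ) =>
      EnumAt p.1.1 p.1.2 u ∧ rep p.2.1 u = p.2.2 := by
    refine PrimrecPred.and ?_ ?_
    · exact primrec_enumAt.comp (Primrec.pair (Primrec.fst.comp (Primrec.fst.comp Primrec.snd))
        (Primrec.pair (Primrec.snd.comp (Primrec.fst.comp Primrec.snd)) Primrec.fst))
    · exact Primrec.eq.comp (primrec_rep.comp
        (Primrec.fst.comp (Primrec.snd.comp Primrec.snd)) Primrec.fst)
        (Primrec.snd.comp (Primrec.snd.comp Primrec.snd))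
  exact (h.exists_mem_list.comp (Primrec.list_range.comp (Primrec.snd.comp Primrec.fst))
    Primrec.id).of_eq fun p => by simp [Hits]

theorem primrec_enabled :
    PrimrecPred fun p : (ℕ × List (ℕ × ℕ)) × ℕ => Enabled p.1.1 p.1.2 p.2 := by
  have hs : Primrec fun p : (ℕ × List (ℕ × ℕ)) × ℕ => p.1.1 := Primrec.fst.comp Primrec.fst
  have hH : Primrec fun p : (ℕ × List (ℕ × ℕ)) × ℕ => p.1.2 := Primrec.snd.comp Primrec.fst
  have ha : Primrec fun p : (ℕ × List (ℕ × ℕ)) × ℕ => p.2.unpair.1 :=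
    Primrec.fst.comp (Primrec.unpair.comp Primrec.snd)
  have hb : Primrec fun p : (ℕ × List (ℕ × ℕ)) × ℕ => p.2.unpair.2 :=
    Primrec.snd.comp (Primrec.unpair.comp Primrec.snd)
  have h : PrimrecRel fun (q : ℕ) (p : (ℕ × List (ℕ × ℕ)) × ℕ) =>
      Hits q p.1.1 p.1.2 p.2.unpair.2 ∧ ¬ Hits q p.1.1 p.1.2 p.2.unpair.1 := by
    refine PrimrecPred.and ?_ (PrimrecPred.not ?_)
    · exact primrec_hits.comp (Primrec.pair (Primrec.pair Primrec.fst (hs.comp Primrec.snd))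
        (Primrec.pair (hH.comp Primrec.snd) (hb.comp Primrec.snd)))
    · exact primrec_hits.comp (Primrec.pair (Primrec.pair Primrec.fst (hs.comp Primrec.snd))
        (Primrec.pair (hH.comp Primrec.snd) (ha.comp Primrec.snd)))
  refine PrimrecPred.and (PrimrecPred.and ?_ (PrimrecPred.and ?_ ?_)) ?_
  · exact Primrec.nat_lt.comp ha hb
  · exact Primrec.eq.comp (primrec_rep.comp hH ha) ha
  · exact Primrec.eq.comp (primrec_rep.comp hH hb) hb
  · exact (h.exists_mem_list.comp (Primrec.list_range.comp
      (primrec_width.comp (primrec_idx.comp hH hb))) Primrec.id).of_eq fun p => by simp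

theorem primrec_act : Primrec₂ act := by
  have h : Primrec fun p : ℕ × List (ℕ × ℕ) =>
      (List.range p.1).findIdx (fun c => decide (Enabled p.1 p.2 c)) := by
    refine Primrec.list_findIdx (Primrec.list_range.comp Primrec.fst) ?_
    exact (primrec_enabled.decide).to₂
  exact (Primrec.ite (Primrec.nat_lt.comp h Primrec.fst) (Primrec.unpair.comp h)
    (Primrec.const (0, 0))).to₂

theorem primrec_hist : Primrec hist := by
  refine (Primrec.nat_rec₁ (f := fun s H => act s H :: H) [] ?_).of_eq ?_
  · exact Primrec.list_cons.comp (primrec_act.comp Primrec.fst Primrec.snd) Primrec.snd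
  · intro n
    induction n with
    | zero => rfl
    | succ n ih => rw [hist, ← ih]

theorem primrec_r : Primrec₂ r :=
  primrec_rep.comp (primrec_hist.comp Primrec.fst) Primrec.snd

/-! ### Single stages of the construction -/

theorem EnumAt.lt {q s x : ℕ} (h : EnumAt q s x) : x < s := by
  obtain ⟨y, hy⟩ := Option.isSome_iff_exists.1 h
  exact (Nat.right_le_pair _ _).trans_lt (evaln_bound hy)

theorem EnumAt.mono {q s t x : ℕ} (hst : s ≤ t) (h : EnumAt q s x) : EnumAt q t x := by
  obtain ⟨y, hy⟩ := Option.isSome_iff_exists.1 h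
  exact Option.isSome_iff_exists.2 ⟨y, evaln_mono hst hy⟩

theorem mem_U_iff {q x : ℕ} : x ∈ U q ↔
    ((Denumerable.ofNat Code q.unpair.1).eval (Nat.pair q.unpair.2 x)).Dom := by
  rw [Part.dom_iff_mem]
  simp only [evaln_complete, U, EnumAt, Option.isSome_iff_exists, Set.mem_ofPred_eq, Option.mem_def]
  exact exists_comm

theorem hits_iff {q s v : ℕ} {H : List (ℕ × ℕ)} :
    Hits q s H v ↔ ∃ u, EnumAt q s u ∧ rep H u = v :=
  ⟨fun ⟨u, _, h⟩ => ⟨u, h⟩, fun ⟨u, h⟩ => ⟨u, h.1.lt, h⟩⟩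

theorem act_eq_of_enabled {s c : ℕ} {H : List (ℕ × ℕ)} (hc : c < s) (h : Enabled s H c) :
    ∃ d ≤ c, Enabled s H d ∧ act s H = d.unpair := by
  set p : ℕ → Bool := fun c => decide (Enabled s H c) with hp
  have hle : (List.range s).findIdx p ≤ c := by
    by_contra! hlt
    have := List.not_of_lt_findIdx hlt
    simp [hp, h] at this
  have hlt : (List.range s).findIdx p < (List.range s).length := by
    simpa using hle.trans_lt hc
  refine ⟨(List.range s).findIdx p, hle, ?_, ?_⟩
  · have := List.findIdx_getElem (w := hlt)
    simpa [hp] using this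
  · rw [act, if_pos (hle.trans_lt hc)]

theorem act_cases (s : ℕ) (H : List (ℕ × ℕ)) :
    act s H = (0, 0) ∨ ∃ d, Enabled s H d ∧ act s H = d.unpair := by
  by_cases h : ∃ c < s, Enabled s H c
  · obtain ⟨c, hc, h⟩ := h
    obtain ⟨d, -, hd⟩ := act_eq_of_enabled hc h
    exact Or.inr ⟨d, hd⟩
  · left
    rw [act, if_neg]
    intro hlt
    refine h ⟨_, hlt, ?_⟩
    have := List.findIdx_getElem (xs := List.range s) (p := fun c => decide (Enabled s H c))
      (w := by simpa using hlt)
    simpa using this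

theorem r_succ (s x : ℕ) :
    r (s + 1) x = if r s x = (act s (hist s)).2 then (act s (hist s)).1 else r s x := rfl

theorem r_succ_cases (s : ℕ) : (∀ x, r (s + 1) x = r s x) ∨
    ∃ a b q, a < b ∧ r s a = a ∧ r s b = b ∧ q < width (idx (hist s) b) ∧
      Hits q s (hist s) b ∧ ¬ Hits q s (hist s) a ∧
      ∀ x, r (s + 1) x = if r s x = b then a else r s x := by
  rcases act_cases s (hist s) with h | ⟨d, ⟨⟨h1, h2, h3⟩, q, h4, h5, h6⟩, hd⟩
  · left
    intro x
    rw [r_succ, h]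
    split_ifs with h0
    · exact h0.symm
    · rfl
  · exact Or.inr ⟨_, _, q, h1, h2, h3, h4, h5, h6, fun x => by rw [r_succ, hd]⟩

theorem r_succ_le (s x : ℕ) : r (s + 1) x ≤ r s x := by
  rcases r_succ_cases s with h | ⟨a, b, q, hab, -, -, -, -, -, h⟩
  · exact (h x).le
  · rw [h]; split_ifs with h0
    · omega
    · rfl

theorem r_antitone (x : ℕ) : Antitone fun s => r s x :=
  antitone_nat_of_succ_le fun s => r_succ_le s x

theorem r_le (s x : ℕ) : r s x ≤ x := r_antitone x (Nat.zero_le s)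

theorem r_idem (s x : ℕ) : r s (r s x) = r s x := by
  induction s generalizing x with
  | zero => rfl
  | succ s ih =>
    rcases r_succ_cases s with h | ⟨a, b, q, hab, ha, hb, -, -, -, h⟩
    · rw [h, h, ih]
    · rw [h x]
      split_ifs with h0
      · rw [h, ha, if_neg hab.ne]
      · rw [h, ih, if_neg h0]

theorem r_congr {s t x y : ℕ} (hst : s ≤ t) (h : r s x = r s y) : r t x = r t y := by
  induction t, hst using Nat.le_induction with
  | base => exact h
  | succ t _ ih => rw [r_succ, r_succ, ih]

/-! ### The limit of the construction -/

theorem exists_limit (x : ℕ) : ∃ v, ∀ᶠ s in atTop, r s x = v := by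
  obtain ⟨v, hv⟩ : ∃ v ∈ Set.range (fun s => r s x), ∀ w ∈ Set.range (fun s => r s x), v ≤ w :=
    ⟨sInf _, Nat.sInf_mem ⟨_, 0, rfl⟩, fun w hw => Nat.sInf_le hw⟩
  obtain ⟨⟨s, rfl⟩, h⟩ := hv
  exact ⟨_, eventually_atTop.2 ⟨s, fun t ht => le_antisymm (r_antitone x ht) (h _ ⟨t, rfl⟩)⟩⟩

/-- The least element of the class of `x` in the limit. -/
noncomputable def rho (x : ℕ) : ℕ := (exists_limit x).choose

theorem eventually_r_eq (x : ℕ) : ∀ᶠ s in atTop, r s x = rho x := (exists_limit x).choose_spec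

theorem eventually_forall_r_eq (N : ℕ) : ∀ᶠ s in atTop, ∀ x ≤ N, r s x = rho x :=
  (eventually_all_finite (Set.finite_Iic N)).2 fun x _ => eventually_r_eq x

theorem rho_le_r (s x : ℕ) : rho x ≤ r s x := by
  obtain ⟨t, ht, hst⟩ := ((eventually_r_eq x).and (eventually_ge_atTop s)).exists
  exact ht ▸ r_antitone x hst

theorem rho_idem (x : ℕ) : rho (rho x) = rho x := by
  obtain ⟨t, h1, h2⟩ := ((eventually_r_eq x).and (eventually_r_eq (rho x))).exists
  rw [← h2, ← h1, r_idem]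

theorem rho_eq_iff {x y : ℕ} : rho x = rho y ↔ ∃ s, r s x = r s y := by
  constructor
  · intro h
    obtain ⟨t, h1, h2⟩ := ((eventually_r_eq x).and (eventually_r_eq y)).exists
    exact ⟨t, by rw [h1, h2, h]⟩
  · rintro ⟨s, h⟩
    obtain ⟨t, ⟨h1, h2⟩, h3⟩ :=
      (((eventually_r_eq x).and (eventually_r_eq y)).and (eventually_ge_atTop s)).exists
    rw [← h1, ← h2, r_congr h3 h]

theorem rho_r (s x : ℕ) : rho (r s x) = rho x := rho_eq_iff.2 ⟨s, r_idem s x⟩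

theorem r_of_root {x : ℕ} (h : rho x = x) (s : ℕ) : r s x = x :=
  le_antisymm (r_le s x) (h.ge.trans (rho_le_r s x))

/-- The number of final representatives below `x`. -/
noncomputable def index (x : ℕ) : ℕ := Nat.count (fun y => rho y = y) x

theorem r_eq_self_of_ge (s : ℕ) : ∃ N, ∀ x ≥ N, r s x = x := by
  induction s with
  | zero => exact ⟨0, fun _ _ => rfl⟩
  | succ s ih =>
    obtain ⟨N, hN⟩ := ih
    rcases r_succ_cases s with h | ⟨a, b, q, -, -, -, -, -, -, h⟩
    · exact ⟨N, fun x hx => (h x).trans (hN x hx)⟩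
    · refine ⟨max N (b + 1), fun x hx => ?_⟩
      rw [h, hN x ((le_max_left _ _).trans hx), if_neg]
      have := (le_max_right _ _).trans hx
      omega

theorem count_eq_of_forall_not {p : ℕ → Prop} [DecidablePred p] {m n : ℕ} (hmn : m ≤ n)
    (h : ∀ k, m ≤ k → k < n → ¬ p k) : Nat.count p n = Nat.count p m := by
  induction n, hmn using Nat.le_induction with
  | base => rfl
  | succ n hn ih =>
    rw [Nat.count_succ, if_neg (h n hn n.lt_succ_self), add_zero]
    exact ih fun k hk hkn => h k hk (hkn.trans n.lt_succ_self)

theorem count_congr_lt {p q : ℕ → Prop} [DecidablePred p] [DecidablePred q] {n : ℕ}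
    (h : ∀ k < n, (p k ↔ q k)) : Nat.count p n = Nat.count q n := by
  induction n with
  | zero => simp
  | succ n ih =>
    rw [Nat.count_succ, Nat.count_succ, ih fun k hk => h k (hk.trans n.lt_succ_self)]
    simp [h n n.lt_succ_self]

theorem idx_eq_index {s x : ℕ} (h : ∀ y < x, r s y = rho y) : idx (hist s) x = index x := by
  refine count_congr_lt fun y hy => ?_
  have : rep (hist s) y = rho y := h y hy
  rw [this]

/-- The class of a final representative only grows, so a hit is never lost. -/
theorem Hits.succ_of_root {q s a : ℕ} (ha : rho a = a) (h : Hits q s (hist s) a) :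
    Hits q (s + 1) (hist (s + 1)) a := by
  rw [hits_iff] at h ⊢
  obtain ⟨u, hu, h⟩ := h
  refine ⟨u, hu.mono s.le_succ, ?_⟩
  have h' : r s u = r s a := h.trans (r_of_root ha s).symm
  exact (r_congr s.le_succ h').trans (r_of_root ha _)

theorem Hits.mono_of_root {q s t a : ℕ} (ha : rho a = a) (hst : s ≤ t) (h : Hits q s (hist s) a) :
    Hits q t (hist t) a := by
  induction t, hst using Nat.le_induction with
  | base => exact h
  | succ t _ ih => exact ih.succ_of_root ha

/-- If all final representatives lay below `B`, the least representative that is at least `B` at a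
late stage could only be absorbed because of a new hit on a class below `B`. Only finitely many such
hits ever occur, so it would survive. -/
theorem infinite_roots : {x | rho x = x}.Infinite := by
  intro hfin
  obtain ⟨B, hB⟩ : ∃ B, ∀ x, rho x = x → x < B := by
    obtain ⟨B, hB⟩ := hfin.bddAbove
    exact ⟨B + 1, fun x hx => Nat.lt_succ_of_le (hB hx)⟩
  have hstab := eventually_forall_r_eq B
  -- Each of the finitely many pairs `(a, q)` turns from no hit to hit at most once.
  have hq : ∀ᶠ s in atTop, ∀ a ∈ Set.Iio B, ∀ q ∈ Set.Iio (width (index B)), rho a = a →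
      Hits q (s + 1) (hist (s + 1)) a → Hits q s (hist s) a := by
    refine (eventually_all_finite (Set.finite_Iio B)).2 fun a _ =>
      (eventually_all_finite (Set.finite_Iio _)).2 fun q _ => ?_
    by_cases h : ∃ s, rho a = a ∧ Hits q s (hist s) a
    · obtain ⟨s, ha, h⟩ := h
      filter_upwards [eventually_ge_atTop s] with t ht _ _
      exact h.mono_of_root ha ht
    · push Not at h
      exact Eventually.of_forall fun s ha hs => absurd hs (h _ ha)
  obtain ⟨s₀, hs₀⟩ := eventually_atTop.1 (hstab.and hq)
  -- the least representative at stage `s₀` which is at least `B`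
  have hex : ∃ b, B ≤ b ∧ r s₀ b = b := by
    obtain ⟨N, hN⟩ := r_eq_self_of_ge s₀
    exact ⟨max N B, le_max_right _ _, hN _ (le_max_left _ _)⟩
  have hfind := Nat.find_spec hex
  set b := Nat.find hex with hb
  have hkeep : ∀ s ≥ s₀, r s b = b ∧ ∀ y, B ≤ y → y < b → r s y ≠ y := by
    intro s hs
    induction s, hs using Nat.le_induction with
    | base => exact ⟨hfind.2, fun y hy hyb h => Nat.find_min hex hyb ⟨hy, h⟩⟩
    | succ s hs ih =>
      have hlow : ∀ y, B ≤ y → y < b → r (s + 1) y ≠ y := fun y hy hyb h =>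
        ih.2 y hy hyb (le_antisymm (r_le s y) (h.ge.trans (r_succ_le s y)))
      refine ⟨?_, hlow⟩
      rcases r_succ_cases s with h | ⟨a, b', q, hab, ha, hb', hqw, hit, nhit, h⟩
      · rw [h, ih.1]
      · rw [h, ih.1]
        split_ifs with hbb
        · exfalso
          subst hbb
          have haB : a < B := by
            by_contra! hBa
            exact ih.2 a hBa hab ha
          have haroot : rho a = a := by rw [← (hs₀ s hs).1 a haB.le, ha]
          have hidx : idx (hist s) b = index B := by
            rw [← idx_eq_index fun y hy => (hs₀ s hs).1 y hy.le]
            exact count_eq_of_forall_not hfind.1 ih.2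
          rw [hidx] at hqw
          -- The merge hands the hit on `b` to `a` at stage `s + 1`; no new hits occur any more, so
          -- `a` was hit before.
          refine nhit ((hs₀ s hs).2 a haB q hqw haroot ?_)
          rw [hits_iff] at hit ⊢
          obtain ⟨u, hu, hub⟩ := hit
          refine ⟨u, hu.mono s.le_succ, (h u).trans (if_pos hub)⟩
        · rfl
  have hroot : rho b = b := by
    obtain ⟨s, h1, h2⟩ := ((eventually_r_eq b).and (eventually_ge_atTop s₀)).exists
    rw [← h1, (hkeep s h2).1]
  exact absurd (hB b hroot) (not_lt.2 hfind.1)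

/-- The basic property of the construction. -/
theorem key {a b q : ℕ} (ha : rho a = a) (hb : rho b = b) (hab : a < b)
    (hq : q < width (index b)) (h : ∃ u ∈ U q, rho u = b) : ∃ u ∈ U q, rho u = a := by
  by_contra! hno
  obtain ⟨u, ⟨s₁, hu⟩, hub⟩ := h
  obtain ⟨s, hs⟩ := eventually_atTop.1 (((eventually_forall_r_eq b).and (eventually_r_eq u)).and
    ((eventually_ge_atTop s₁).and (eventually_gt_atTop (Nat.pair a b))))
  obtain ⟨⟨hrb, hru⟩, hs1, hs2⟩ := hs s le_rfl
  have hen : Enabled s (hist s) (Nat.pair a b) := by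
    simp only [Enabled, Nat.unpair_pair]
    refine ⟨⟨hab, r_of_root ha s, r_of_root hb s⟩, q, ?_, ?_, ?_⟩
    · rwa [idx_eq_index fun y hy => hrb y hy.le]
    · exact hits_iff.2 ⟨u, hu.mono hs1, hru.trans hub⟩
    · rw [hits_iff]
      rintro ⟨v, hv, hva⟩
      refine hno v ⟨s, hv⟩ ?_
      rw [← rho_r s v]
      exact (congrArg rho hva).trans ha
  -- The stage merges the least enabled pair. Since `Nat.pair x y = y * y + x` for `x < y`, that
  -- pair moves an element at most `b`, although these have all settled.
  obtain ⟨d, hd, ⟨⟨h1, -, h3⟩, -⟩, hact⟩ := act_eq_of_enabled hs2 hen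
  have hdb : d.unpair.2 ≤ b := by
    by_contra! hlt
    rw [← Nat.pair_unpair d] at hd
    rw [Nat.pair, Nat.pair, if_pos h1, if_pos hab] at hd
    nlinarith
  have h4 := (hs (s + 1) s.le_succ).1.1 _ hdb
  rw [← hrb _ hdb, r_succ, hact] at h4
  have h3' : r s d.unpair.2 = d.unpair.2 := h3
  rw [h3', if_pos rfl] at h4
  exact h1.ne h4

/-! ### Recursively enumerable sets -/

theorem re_exists {α : Type*} [Primcodable α] {P : α → ℕ → Prop} 
    (h : ComputablePred fun p : α × ℕ => P p.1 p.2) : REPred fun a => ∃ n, P a n := by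
  classical
  have h1 : Partrec fun a => Nat.rfind fun n => (Part.some (decide (P a n)) : Part Bool) :=
    Partrec.rfind h.decide.partrec
  refine h1.dom_re.of_eq fun a => Iff.trans Nat.rfind_dom ⟨?_, ?_⟩
  · rintro ⟨n, hn, -⟩
    exact ⟨n, of_decide_eq_true (Part.mem_some_iff.1 hn).symm⟩
  · rintro ⟨n, hn⟩
    exact ⟨n, Part.mem_some_iff.2 (decide_eq_true hn).symm, fun _ => trivial⟩

theorem IsRE.exists_W {A : Set ℕ} (h : IsRE A) : ∃ e, A = W e := by
  have h1 : Partrec fun x : ℕ => (Part.assert (x ∈ A) fun _ => Part.some ()).map fun _ => 0 :=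
    Partrec.map h (Computable.const 0).to₂
  obtain ⟨c, hc⟩ := exists_code.1 (Partrec.nat_iff.1 h1)
  refine ⟨Encodable.encode c, ?_⟩
  ext x
  simp only [W, Denumerable.ofNat_encode, hc, Set.mem_ofPred_eq]
  exact ⟨fun h => ⟨h, trivial⟩, fun h => h.1⟩

/-- The position of `W e` in the uniformly r.e. list used in the construction. -/
def position (e : ℕ) : ℕ :=
  Nat.pair (Encodable.encode (Code.comp (Denumerable.ofNat Code e) Code.right)) 0

theorem U_position (e : ℕ) : U (position e) = W e := by
  ext x
  rw [mem_U_iff]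
  simp only [position, W, Nat.unpair_pair, Denumerable.ofNat_encode, Set.mem_ofPred_eq, Code.eval]
  simp
  exact Iff.of_eq (congrArg Part.Dom (Part.bind_some _ _))

/-- An infinite part of the index set suffices for the families; strict monotonicity makes the
chosen members distinct. -/
theorem exists_strictMono_computable {S : Set ℕ} (hS : IsRE S) (hinf : S.Infinite) :
    ∃ f : ℕ → ℕ, Computable f ∧ StrictMono f ∧ ∀ t, f t ∈ S := by
  obtain ⟨e, rfl⟩ := hS.exists_W
  let P : ℕ → ℕ → Prop := fun y c => y < c.unpair.1 ∧
    (evaln c.unpair.2 (Denumerable.ofNat Code e) c.unpair.1).isSome = true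
  have hP : PrimrecRel P := by
    have h1 : Primrec fun p : ℕ × ℕ => p.2.unpair.1 :=
      Primrec.fst.comp (Primrec.unpair.comp Primrec.snd)
    have h2 : Primrec fun p : ℕ × ℕ => p.2.unpair.2 :=
      Primrec.snd.comp (Primrec.unpair.comp Primrec.snd)
    refine PrimrecPred.and (Primrec.nat_lt.comp Primrec.fst h1) (Primrec.eq.comp
      (Primrec.option_isSome.comp (primrec_evaln.comp
        (Primrec.pair (Primrec.pair h2 (Primrec.const _)) h1))) (Primrec.const true))
  have hex : ∀ y, ∃ c, P y c := by
    intro y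
    obtain ⟨x, hx, hyx⟩ := hinf.exists_gt y
    obtain ⟨v, hv⟩ := Part.dom_iff_mem.1 hx
    obtain ⟨k, hk⟩ := evaln_complete.1 hv
    refine ⟨Nat.pair x k, ?_⟩
    simp only [P, Nat.unpair_pair]
    exact ⟨hyx, Option.isSome_iff_exists.2 ⟨v, hk⟩⟩
  have hfind : Computable fun y => Nat.find (hex y) :=
    Computable.find hP.computablePred hex
  let next : ℕ → ℕ := fun y => (Nat.find (hex y)).unpair.1
  have hnext : Computable next :=
    Computable.fst.comp (Computable.unpair.comp hfind)
  have hlt : ∀ y, y < next y := fun y => (Nat.find_spec (hex y)).1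
  have hmem : ∀ y, next y ∈ W e := by
    intro y
    obtain ⟨v, hv⟩ := Option.isSome_iff_exists.1 (Nat.find_spec (hex y)).2
    exact Part.dom_iff_mem.2 ⟨v, evaln_sound hv⟩
  let f : ℕ → ℕ := fun t => Nat.rec (motive := fun _ => ℕ) (next 0) (fun _ v => next v) t
  refine ⟨f, ?_, strictMono_nat_of_lt_succ fun t => hlt _, fun t => ?_⟩
  · exact Computable.nat_rec Computable.id (Computable.const _)
      (hnext.comp (Computable.snd.comp Computable.snd)).to₂
  · cases t <;> exact hmem _

/-- A single code `e` serves the whole sequence, so the position of the `t`-th member grows only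
quadratically in `t`; the pigeonhole count for families depends on this. -/
theorem exists_U_eq_W {f : ℕ → ℕ} (hf : Computable f) : ∃ e, ∀ t, U (Nat.pair e t) = W (f t) := by
  have h : Partrec fun n : ℕ => (Denumerable.ofNat Code (f n.unpair.1)).eval n.unpair.2 :=
    eval_part.comp ((Computable.ofNat Code).comp
      (hf.comp (Computable.fst.comp Computable.unpair)))
      (Computable.snd.comp Computable.unpair)
  obtain ⟨c, hc⟩ := exists_code.1 (Partrec.nat_iff.1 h)
  refine ⟨Encodable.encode c, fun t => ?_⟩
  ext x
  rw [mem_U_iff]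
  simp [W, hc]

/-! ### The equivalence relation -/

/-- The equivalence relation given by the limit of the construction. -/
noncomputable def theta : Setoid ℕ := Setoid.ker rho

theorem theta_iff {x y : ℕ} : theta x y ↔ rho x = rho y := Iff.rfl

theorem re_theta : REPred fun p : ℕ × ℕ => theta p.1 p.2 := by
  have h : PrimrecPred fun p : (ℕ × ℕ) × ℕ => r p.2 p.1.1 = r p.2 p.1.2 :=
    Primrec.eq.comp (primrec_r.comp Primrec.snd (Primrec.fst.comp Primrec.fst))
      (primrec_r.comp Primrec.snd (Primrec.snd.comp Primrec.fst))
  have h2 : REPred fun p : ℕ × ℕ => ∃ s, r s p.1 = r s p.2 :=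
    re_exists (P := fun (p : ℕ × ℕ) s => r s p.1 = r s p.2) h.computablePred
  exact h2.of_eq fun p => rho_eq_iff.symm

/-- The class of `x`. -/
def cls (x : ℕ) : Set ℕ := {y | rho y = rho x}

theorem classes_theta : theta.classes = Set.range cls := by
  ext c
  exact ⟨fun ⟨y, hy⟩ => ⟨y, hy.symm⟩, fun ⟨y, hy⟩ => ⟨y, hy.symm⟩⟩

theorem injOn_cls : Set.InjOn cls {x | rho x = x} := by
  intro x hx y hy h
  have : x ∈ cls y := h ▸ (rfl : rho x = rho x)
  rw [← show rho x = x from hx, ← show rho y = y from hy]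
  exact this

theorem infinite_classes : theta.classes.Infinite := by
  rw [classes_theta]
  exact (infinite_roots.image injOn_cls).mono (Set.image_subset_range _ _)

theorem isPositive_theta : IsPositive theta := ⟨re_theta, infinite_classes⟩

/-- A set is saturated if it is a union of classes. -/
def Saturated (A : Set ℕ) : Prop := ∀ x, rho x ∈ A ↔ x ∈ A

theorem saturated_sUnion {C : Set (Set ℕ)} (hC : C ⊆ theta.classes) : Saturated (⋃₀ C) := by
  intro x
  refine exists_congr fun c => and_congr_right fun hc => ?_
  obtain ⟨y, rfl⟩ := classes_theta ▸ hC hc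
  simp [cls, rho_idem]

theorem image_cls_sUnion {C : Set (Set ℕ)} (hC : C ⊆ theta.classes) :
    cls '' {x | x ∈ ⋃₀ C ∧ rho x = x} = C := by
  ext c
  constructor
  · rintro ⟨x, ⟨⟨d, hd, hxd⟩, -⟩, rfl⟩
    obtain ⟨y, rfl⟩ := classes_theta ▸ hC hd
    have : cls x = cls y := by
      ext z
      simp only [cls, Set.mem_ofPred_eq] at hxd ⊢
      rw [hxd]
    rwa [this]
  · intro hc
    obtain ⟨y, rfl⟩ := classes_theta ▸ hC hc
    refine ⟨rho y, ⟨⟨_, hc, rho_idem y⟩, rho_idem y⟩, ?_⟩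
    ext z
    simp [cls, rho_idem]

theorem EtaFinite.saturated {A : Set ℕ} (h : EtaFinite theta A) : Saturated A := by
  obtain ⟨C, hC, -, rfl⟩ := h
  exact saturated_sUnion hC

theorem EtaInfinite.saturated {A : Set ℕ} (h : EtaInfinite theta A) : Saturated A := by
  obtain ⟨C, hC, -, rfl⟩ := h
  exact saturated_sUnion hC

theorem EtaClosed.saturated {A : Set ℕ} (h : EtaClosed theta A) : Saturated A :=
  h.elim EtaFinite.saturated EtaInfinite.saturated

theorem EtaFinite.finite_roots {A : Set ℕ} (h : EtaFinite theta A) :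
    {x | x ∈ A ∧ rho x = x}.Finite := by
  obtain ⟨C, hC, hfin, rfl⟩ := h
  refine Set.Finite.of_finite_image ?_ (injOn_cls.mono fun x hx => hx.2)
  rwa [image_cls_sUnion hC]

theorem EtaInfinite.infinite_roots {A : Set ℕ} (h : EtaInfinite theta A) :
    {x | x ∈ A ∧ rho x = x}.Infinite := by
  obtain ⟨C, hC, hinf, rfl⟩ := h
  refine Set.Infinite.of_image cls ?_
  rwa [image_cls_sUnion hC]

/-! ### Indices of final representatives and downward closure of r.e. sets -/

theorem index_lt_index {x y : ℕ} (hx : rho x = x) (hxy : x < y) : index x < index y :=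
  Nat.count_strict_mono hx hxy

theorem index_le_index {x y : ℕ} (hxy : x ≤ y) : index x ≤ index y :=
  Nat.count_monotone _ hxy

/-- The `n`-th final representative. -/
noncomputable def root (n : ℕ) : ℕ := Nat.nth (fun x => rho x = x) n

theorem rho_root (n : ℕ) : rho (root n) = root n := Nat.nth_mem_of_infinite infinite_roots n

theorem index_root (n : ℕ) : index (root n) = n := Nat.count_nth_of_infinite infinite_roots n

theorem root_index {x : ℕ} (hx : rho x = x) : root (index x) = x := Nat.nth_count hx

theorem lt_of_index_lt {x y : ℕ} (h : index x < index y) : x < y := by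
  by_contra! hyx
  exact absurd (index_le_index hyx) (not_le.2 h)

theorem mem_of_mem_U {A : Set ℕ} (hA : Saturated A) {a b q : ℕ} (hU : U q = A) (ha : rho a = a)
    (hb : rho b = b) (hab : a < b) (hq : q < width (index b)) (h : b ∈ A) : a ∈ A := by
  obtain ⟨u, hu, hua⟩ := key ha hb hab hq ⟨b, hU ▸ h, hb⟩
  rw [← hua, hA, ← hU]
  exact hu

theorem lt_width (m : ℕ) : m < width m := by
  have := @Nat.lt_two_pow_self m
  unfold width
  nlinarith

/-- The position of the set is fixed, while the set has representatives of arbitrarily large index;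
each of these pulls in all smaller ones by `key`. -/
theorem eq_univ_of_etaInfinite {A : Set ℕ} (hA : IsRE A) (h : EtaInfinite theta A) :
    A = Set.univ := by
  obtain ⟨e, rfl⟩ := hA.exists_W
  have hsat := h.saturated
  refine Set.eq_univ_of_forall fun x => (hsat x).1 ?_
  obtain ⟨b, ⟨hb, hbr⟩, hlt⟩ := h.infinite_roots.exists_gt (max (rho x) (root (position e)))
  refine mem_of_mem_U hsat (U_position e) (rho_idem x) hbr ((le_max_left _ _).trans_lt hlt) ?_ hb
  have h1 := index_lt_index (rho_root (position e)) ((le_max_right _ _).trans_lt hlt)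
  rw [index_root] at h1
  exact h1.trans (lt_width _)

theorem isRE_univ : IsRE Set.univ := (ComputablePred.to_re
  (PrimrecPred.computablePred (PrimrecPred.of_eq (p := fun x : ℕ => x = x)
    (Primrec.eq.comp Primrec.id Primrec.id) fun x => by simp)))

theorem etaInfinite_univ : EtaInfinite theta Set.univ :=
  ⟨theta.classes, subset_rfl, infinite_classes, theta.sUnion_classes.symm⟩

theorem isRE_W (e : ℕ) : IsRE (W e) :=
  (eval_part.comp (Computable.const _) Computable.id).dom_re

/-! ### Families -/

theorem IsEtaFamily.isRE {F : Set (Set ℕ)} (hF : IsEtaFamily theta F) {L : Set ℕ} (hL : L ∈ F) :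
    IsRE L := by
  obtain ⟨-, ⟨S, -, -, rfl⟩, -⟩ := hF
  obtain ⟨i, -, rfl⟩ := hL
  exact isRE_W i

theorem IsEtaFamily.etaFinite {F : Set (Set ℕ)} (hF : IsEtaFamily theta F) {L : Set ℕ}
    (hL : L ∈ F) (hne : L ≠ Set.univ) : EtaFinite theta L :=
  (hF.2.2 L hL).resolve_right fun h => hne (eq_univ_of_etaInfinite (hF.isRE hL) h)

/-- This explains the square in `width`: it covers all pairs of a code and a member number below `2
^ m + 2`. -/
theorem pair_lt_width {e t m : ℕ} (he : e < 2 ^ m + 2) (ht : t < 2 ^ m + 2) :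
    Nat.pair e t < width m := by
  refine (Nat.pair_lt_max_add_one_sq e t).trans_le ?_
  have h : max e t + 1 ≤ 2 ^ m + 2 := Nat.succ_le_of_lt (max_lt he ht)
  rw [sq]
  exact Nat.mul_le_mul h h

theorem width_mono {m n : ℕ} (h : m ≤ n) : width m ≤ width n := by
  have := Nat.pow_le_pow_right (n := 2) (by norm_num) h
  exact Nat.mul_le_mul (Nat.add_le_add_right this 2) (Nat.add_le_add_right this 2)

theorem IsEtaFamily.exists_mem_of_index_lt {F : Set (Set ℕ)} (hF : IsEtaFamily theta F) (k : ℕ) :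
    ∃ L ∈ F, L ≠ Set.univ ∧ ∀ b, rho b = b → index b < k → b ∈ L := by
  classical
  obtain ⟨hinf, ⟨S, hS, hinj, rfl⟩, hcl⟩ := hF
  have hSinf : S.Infinite := hinf.of_image W
  obtain ⟨f, hf, hmono, hfS⟩ := exists_strictMono_computable hS hSinf
  obtain ⟨e, he⟩ := exists_U_eq_W hf
  have hsat : ∀ t, Saturated (W (f t)) := fun t =>
    EtaClosed.saturated (hcl _ (Set.mem_image_of_mem W (hfS t)))
  by_contra! hno
  replace hno : ∀ t, W (f t) ≠ Set.univ → ∃ b, rho b = b ∧ index b < k ∧ b ∉ W (f t) :=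
    fun t => hno _ (Set.mem_image_of_mem W (hfS t))
  -- From `k ≤ m` every missing representative is visible in the trace on the first `m`; from `e ≤
  -- m` the positions fall below `width m`.
  set m := max k e with hm
  -- the sets different from `ℕ` have no representatives of index at least `m`
  have hlow : ∀ t < 2 ^ m + 2, W (f t) ≠ Set.univ → ∀ b, rho b = b → b ∈ W (f t) →
      index b < m := by
    intro t ht hne b hb hbt
    by_contra! hmb
    obtain ⟨a, ha, hak, hat⟩ := hno t hne
    refine hat (mem_of_mem_U (hsat t) (he t) ha hb ?_ ?_ hbt)
    · exact lt_of_index_lt (hak.trans_le ((le_max_left k e).trans hmb))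
    · refine (pair_lt_width ?_ ht).trans_le (width_mono hmb)
      have h1 : e ≤ m := le_max_right k e
      have h2 := @Nat.lt_two_pow_self m
      omega
  -- Pigeonhole: `2 ^ m + 2` members but only `2 ^ m` traces.
  obtain ⟨t, ht, t', ht', htt, heq⟩ := Finset.exists_ne_map_eq_of_card_lt_of_maps_to
    (s := Finset.range (2 ^ m + 2)) (t := (Finset.range m).powerset)
    (f := fun t => (Finset.range m).filter fun j => root j ∈ W (f t)) (by simp)
    (fun t _ => Finset.mem_coe.2 (Finset.mem_powerset.2 (Finset.filter_subset _ _)))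
  rw [Finset.mem_range] at ht ht'
  have htrace : ∀ b, rho b = b → index b < m → (b ∈ W (f t) ↔ b ∈ W (f t')) := by
    intro b hb hbm
    have := Finset.ext_iff.1 heq (index b)
    simpa [root_index hb, hbm] using this
  -- The trace also detects `ℕ`, since any other member omits a representative of index below `k`.
  have hne_iff : W (f t) ≠ Set.univ ↔ W (f t') ≠ Set.univ := by
    constructor
    · intro h h'
      obtain ⟨b, hb, hbk, hbt⟩ := hno t h
      exact hbt ((htrace b hb (hbk.trans_le (le_max_left _ _))).2 (h' ▸ Set.mem_univ b))
    · intro h h'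
      obtain ⟨b, hb, hbk, hbt⟩ := hno t' h
      exact hbt ((htrace b hb (hbk.trans_le (le_max_left _ _))).1 (h' ▸ Set.mem_univ b))
  have hW : W (f t) = W (f t') := by
    by_cases hne : W (f t) = Set.univ
    · rw [hne, of_not_not (mt hne_iff.2 (not_not.2 hne))]
    · ext x
      rw [← hsat t x, ← hsat t' x]
      constructor
      · intro h
        exact (htrace _ (rho_idem x) (hlow t ht hne _ (rho_idem x) h)).1 h
      · intro h
        exact (htrace _ (rho_idem x) (hlow t' ht' (hne_iff.1 hne) _ (rho_idem x) h)).2 h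
  exact htt (hmono.injective (hinj (hfS t) (hfS t') hW))

theorem IsEtaFamily.exists_ssuperset {F : Set (Set ℕ)} (hF : IsEtaFamily theta F) {L : Set ℕ}
    (hL : L ∈ F) (hne : L ≠ Set.univ) (n : ℕ) :
    ∃ L' ∈ F, L' ≠ Set.univ ∧ L ⊂ L' ∧ n ∈ L' := by
  have hfin := hF.etaFinite hL hne
  obtain ⟨k, hk⟩ := (hfin.finite_roots.image index).bddAbove
  -- As `k` bounds the indices in `L`, the term `k + 2` forces in `root (k + 1)`, which makes the
  -- inclusion strict; the other term forces in `n`.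
  obtain ⟨L', hL', hne', h⟩ := hF.exists_mem_of_index_lt (max (k + 2) (index (rho n) + 1))
  have hsat' := (hF.etaFinite hL' hne').saturated
  refine ⟨L', hL', hne', ⟨fun x hx => ?_, fun hsub => ?_⟩, ?_⟩
  · have hx' := (hfin.saturated x).2 hx
    refine (hsat' x).1 (h _ (rho_idem x) (lt_max_of_lt_left ?_))
    have := hk ⟨_, ⟨hx', rho_idem x⟩, rfl⟩
    omega
  · have h1 : root (k + 1) ∈ L :=
      hsub (h _ (rho_root _) (lt_max_of_lt_left (by rw [index_root]; omega)))
    have := hk ⟨_, ⟨h1, rho_root _⟩, rfl⟩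
    rw [index_root] at this
    omega
  · exact (hsat' n).1 (h _ (rho_idem n) (lt_max_of_lt_right (Nat.lt_succ_self _)))

theorem IsEtaFamily.exists_chain {F : Set (Set ℕ)} (hF : IsEtaFamily theta F) :
    ∃ B : ℕ → Set ℕ, StrictMono B ∧ (∀ n, B n ∈ F) ∧ (∀ n, EtaFinite theta (B n)) ∧
      ⋃ n, B n = Set.univ := by
  obtain ⟨L₀, hL₀, hne₀, -⟩ := hF.exists_mem_of_index_lt 0
  choose! next h1 h2 h3 h4 using fun (L : {L // L ∈ F ∧ L ≠ Set.univ}) (n : ℕ) =>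
    hF.exists_ssuperset L.2.1 L.2.2 n
  let B : ℕ → {L // L ∈ F ∧ L ≠ Set.univ} := fun n =>
    Nat.rec ⟨L₀, hL₀, hne₀⟩ (fun n L => ⟨next L n, h1 L n, h2 L n⟩) n
  refine ⟨fun n => (B n).1, strictMono_nat_of_lt_succ fun n => h3 (B n) n, fun n => (B n).2.1,
    fun n => hF.etaFinite (B n).2.1 (B n).2.2, ?_⟩
  exact Set.eq_univ_of_forall fun n => Set.mem_iUnion.2 ⟨n + 1, h4 (B n) n⟩

/-! ### Texts -/

/-- The text which starts with `σ` and continues as `T`. -/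
def prepend (σ : List (Option ℕ)) (T : ℕ → Option ℕ) (i : ℕ) : Option ℕ :=
  if h : i < σ.length then σ[i] else T (i - σ.length)

theorem initSeg_length (T : ℕ → Option ℕ) (n : ℕ) : (initSeg T n).length = n := by simp [initSeg]

theorem initSeg_getElem (T : ℕ → Option ℕ) (n i : ℕ) (h : i < (initSeg T n).length) :
    (initSeg T n)[i] = T i := by simp [initSeg]

theorem isPrefix_initSeg_prepend (σ : List (Option ℕ)) (T : ℕ → Option ℕ) {n : ℕ}
    (hn : σ.length ≤ n) : σ <+: initSeg (prepend σ T) n := by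
  rw [List.prefix_iff_getElem]
  refine ⟨by rwa [initSeg_length], fun i hi => ?_⟩
  rw [initSeg_getElem, prepend, dif_pos hi]

theorem isText_prepend {σ : List (Option ℕ)} {T : ℕ → Option ℕ} {L : Set ℕ} (hT : IsText T L)
    (hσ : ∀ x, some x ∈ σ → x ∈ L) : IsText (prepend σ T) L := by
  ext x
  constructor
  · rintro ⟨n, hn⟩
    rw [prepend] at hn
    split_ifs at hn with h
    · exact hσ x (hn ▸ List.getElem_mem h)
    · exact hT ▸ ⟨_, hn⟩
  · intro hx
    obtain ⟨n, hn⟩ := (hT ▸ hx : x ∈ {x | ∃ n, T n = some x})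
    exact ⟨n + σ.length, by rw [prepend, dif_neg (by omega), Nat.add_sub_cancel, hn]⟩

theorem exists_isText (L : Set ℕ) : ∃ T, IsText T L := by
  classical
  refine ⟨fun n => if n ∈ L then some n else none, ?_⟩
  ext x
  simp

theorem IsIndexOf.unique {η : Setoid ℕ} {h : Option ℕ} {L L' : Set ℕ} (h1 : IsIndexOf η h L)
    (h2 : IsIndexOf η h L') : L = L' := by
  obtain ⟨e, rfl, rfl⟩ := h1
  obtain ⟨e', he, rfl⟩ := h2
  rw [Option.some.inj he]

theorem exists_isText_of_prefix {σ : ℕ → List (Option ℕ)} (h : ∀ n, σ n ++ [some n] <+: σ (n + 1)) :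
    ∃ T, IsText T Set.univ ∧ ∀ n, initSeg T (σ n).length = σ n := by
  have hpre : ∀ {m n}, m ≤ n → σ m <+: σ n := by
    intro m n hmn
    induction n, hmn using Nat.le_induction with
    | base => exact List.prefix_rfl
    | succ n _ ih => exact ih.trans ((List.prefix_append _ _).trans (h n))
  have hlen : ∀ n, n ≤ (σ n).length := by
    intro n
    induction n with
    | zero => exact Nat.zero_le _
    | succ n ih =>
      have := (h n).length_le
      rw [List.length_append, List.length_singleton] at this
      omega
  -- The `k`-th entry is read off `σ (k + 1)`, which has length at least `k + 1`.
  have hseg : ∀ n, initSeg (fun k => (σ (k + 1))[k]'(hlen (k + 1))) (σ n).length = σ n := by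
    intro n
    refine List.ext_getElem (initSeg_length _ _) fun i h1 h2 => ?_
    rw [initSeg_getElem]
    rcases le_total n (i + 1) with hle | hle
    · exact ((hpre hle).getElem h2).symm
    · exact (hpre hle).getElem (hlen (i + 1))
  refine ⟨_, Set.eq_univ_of_forall fun n => ?_, hseg⟩
  have hmem : some n ∈ σ (n + 1) := (h n).subset (by simp)
  rw [← hseg (n + 1)] at hmem
  simp only [initSeg, List.mem_map, List.mem_range] at hmem
  obtain ⟨k, -, hk⟩ := hmem
  exact ⟨k, hk⟩

/-- A behaviourally correct learner of a chain with union `ℕ` conjectures infinitely many members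
of the chain on some text for `ℕ`. -/
theorem BCLearns.exists_isText_univ {η : Setoid ℕ} {M : Learner} {F : Set (Set ℕ)}
    (hM : BCLearns η M F) {B : ℕ → Set ℕ} (hB : StrictMono B) (hBF : ∀ n, B n ∈ F)
    (hU : ⋃ n, B n = Set.univ) :
    ∃ T, IsText T Set.univ ∧
      ∀ n, ∃ j ≥ n, ∃ m ≥ n, IsIndexOf η (M (initSeg T j)) (B m) := by
  -- The finite content of `σ ++ [some n]` lies in all late `B m`, so the sequence extends to a text
  -- for such a `B m`, on which the learner must eventually conjecture it.
  have hstep : ∀ (σ : List (Option ℕ)) (n : ℕ), ∃ σ', σ ++ [some n] <+: σ' ∧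
      ∃ m ≥ n, IsIndexOf η (M σ') (B m) := by
    intro σ n
    have hfin : {x | some x ∈ σ ++ [some n]}.Finite :=
      (List.finite_toSet (σ ++ [some n])).preimage (Option.some_injective _).injOn
    have hev : ∀ᶠ m in atTop, ∀ x ∈ {x | some x ∈ σ ++ [some n]}, x ∈ B m := by
      refine (eventually_all_finite hfin).2 fun x _ => ?_
      obtain ⟨m, hm⟩ := Set.mem_iUnion.1 (hU ▸ Set.mem_univ x : x ∈ ⋃ n, B n)
      filter_upwards [eventually_ge_atTop m] with k hk
      exact hB.monotone hk hm
    obtain ⟨m, hm, hnm⟩ := (hev.and (eventually_ge_atTop n)).exists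
    obtain ⟨T, hT⟩ := exists_isText (B m)
    obtain ⟨N, hN⟩ := hM (B m) (hBF m) _ (isText_prepend hT hm)
    exact ⟨_, isPrefix_initSeg_prepend _ T (le_max_right N _), m, hnm, hN _ (le_max_left _ _)⟩
  choose next hpre hidx using hstep
  let σ : ℕ → List (Option ℕ) := fun n => Nat.rec [] (fun n τ => next τ n) n
  obtain ⟨T, hT, hseg⟩ := exists_isText_of_prefix (σ := σ) fun n => hpre (σ n) n
  refine ⟨T, hT, fun n => ?_⟩
  obtain ⟨m, hm, h⟩ := hidx (σ n) n
  refine ⟨(σ (n + 1)).length, ?_, m, hm, ?_⟩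
  · have hlen : ∀ n, n ≤ (σ n).length := by
      intro n
      induction n with
      | zero => exact Nat.zero_le _
      | succ n ih =>
        have := (hpre (σ n) n).length_le
        rw [List.length_append, List.length_singleton] at this
        exact (Nat.succ_le_succ ih).trans this
    exact n.le_succ.trans (hlen (n + 1))
  · exact (hseg (n + 1)).symm ▸ h

/-! ### Limits on confident and behaviourally correct learning -/

theorem ExLearns.bcLearns {η : Setoid ℕ} {M : Learner} {F : Set (Set ℕ)} (hM : ExLearns η M F) :
    BCLearns η M F := by
  intro L hL T hT
  obtain ⟨n, h1, h2⟩ := hM L hL T hT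
  exact ⟨n, fun j hj => h2 j hj ▸ h1⟩

theorem not_confLearnable {F : Set (Set ℕ)} (hF : IsEtaFamily theta F) :
    ¬ ConfLearnable theta F := by
  rintro ⟨M, -, hM, hconf⟩
  obtain ⟨B, hB, hBF, -, hU⟩ := hF.exists_chain
  obtain ⟨T, hT, h⟩ := hM.bcLearns.exists_isText_univ hB hBF hU
  obtain ⟨n, hn⟩ := hconf _ T hT
  obtain ⟨j, hj, m, -, h1⟩ := h n
  -- Asking for `m' ≥ m + 1` yields a second chain member conjectured after convergence.
  obtain ⟨j', hj', m', hm', h2⟩ := h (max n (m + 1))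
  rw [hn j hj] at h1
  rw [hn j' ((le_max_left _ _).trans hj')] at h2
  have := hB.injective (h1.unique h2)
  have := (le_max_right n (m + 1)).trans hm'
  omega

theorem etaFinite_of_bcLearns {F : Set (Set ℕ)} (hF : IsEtaFamily theta F) {M : Learner}
    (hM : BCLearns theta M F) {L : Set ℕ} (hL : L ∈ F) : EtaFinite theta L := by
  refine hF.etaFinite hL ?_
  rintro rfl
  obtain ⟨B, hB, hBF, -, hU⟩ := hF.exists_chain
  obtain ⟨T, hT, h⟩ := hM.exists_isText_univ hB hBF hU
  obtain ⟨n, hn⟩ := hM _ hL T hT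
  obtain ⟨j, hj, m, -, h1⟩ := h n
  have h2 : B m = Set.univ := h1.unique (hn j hj)
  have h3 := hB m.lt_succ_self
  rw [h2] at h3
  exact h3.2 (Set.subset_univ _)

/-! ### Vacillatory and explanatory learning -/

theorem primrecRel_mem {α : Type*} [Primcodable α] : PrimrecRel fun (l : List α) a => a ∈ l :=
  (PrimrecRel.exists_mem_list (R := fun a b : α => a = b) Primrec.eq).of_eq fun l b => by simp

/-- Indices of finite sets can be computed from lists of their elements. -/
theorem exists_computable_listIndex :
    ∃ g : List ℕ → ℕ, Computable g ∧ ∀ l, W (g l) = {x | x ∈ l} := by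
  have hA : IsRE {n : ℕ | n.unpair.2 ∈ Denumerable.ofNat (List ℕ) n.unpair.1} := by
    have h : PrimrecPred fun n : ℕ => n.unpair.2 ∈ Denumerable.ofNat (List ℕ) n.unpair.1 :=
      PrimrecRel.comp (R := fun (l : List ℕ) a => a ∈ l) primrecRel_mem
        ((Primrec.ofNat (List ℕ)).comp (Primrec.fst.comp Primrec.unpair))
        (Primrec.snd.comp Primrec.unpair)
    exact h.computablePred.to_re
  obtain ⟨e, he⟩ := hA.exists_W
  refine ⟨fun l => Encodable.encode (curry (Denumerable.ofNat Code e) (Encodable.encode l)), ?_, ?_⟩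
  · exact (Primrec.encode.comp (primrec₂_curry.comp (Primrec.const _) Primrec.encode)).to_comp
  · intro l
    ext x
    have h := Set.ext_iff.1 he (Nat.pair (Encodable.encode l) x)
    simp only [Set.mem_ofPred_eq, Nat.unpair_pair, Denumerable.ofNat_encode] at h
    simp only [W, Denumerable.ofNat_encode, eval_curry]
    exact h.symm

/-- The least representative of index at least `n` which does not occur in `σ`. -/
def cut (σ : List (Option ℕ)) (n : ℕ) : ℕ :=
  (List.range σ.length).findIdx fun x =>
    decide (r σ.length x = x ∧ n ≤ idx (hist σ.length) x ∧ some x ∉ σ)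

/-- The elements of `σ` below the cut. -/
def core (σ : List (Option ℕ)) (n : ℕ) : List ℕ :=
  (List.range (cut σ n)).filter fun x => decide (some x ∈ σ)

theorem primrec_cut : Primrec₂ cut := by
  have hs : Primrec fun p : (List (Option ℕ) × ℕ) × ℕ => p.1.1.length :=
    Primrec.list_length.comp (Primrec.fst.comp Primrec.fst)
  have h : PrimrecPred fun p : (List (Option ℕ) × ℕ) × ℕ =>
      r p.1.1.length p.2 = p.2 ∧ p.1.2 ≤ idx (hist p.1.1.length) p.2 ∧ some p.2 ∉ p.1.1 := by
    refine PrimrecPred.and ?_ (PrimrecPred.and ?_ (PrimrecPred.not ?_))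
    · exact Primrec.eq.comp (primrec_r.comp hs Primrec.snd) Primrec.snd
    · exact Primrec.nat_le.comp (Primrec.snd.comp Primrec.fst)
        (primrec_idx.comp (primrec_hist.comp hs) Primrec.snd)
    · exact PrimrecRel.comp (R := fun (l : List (Option ℕ)) a => a ∈ l) primrecRel_mem
        (Primrec.fst.comp Primrec.fst) (Primrec.option_some.comp Primrec.snd)
  exact (Primrec.list_findIdx (Primrec.list_range.comp (Primrec.list_length.comp Primrec.fst))
    h.decide.to₂).to₂

theorem primrec_core : Primrec₂ core := by
  have h : PrimrecRel fun (x : ℕ) (σ : List (Option ℕ)) => some x ∈ σ :=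
    PrimrecRel.comp (R := fun (l : List (Option ℕ)) a => a ∈ l) primrecRel_mem Primrec.snd
      (Primrec.option_some.comp Primrec.fst)
  exact (h.listFilter.comp (Primrec.list_range.comp (primrec_cut.comp Primrec.fst Primrec.snd))
    Primrec.fst).to₂

/-- A bound above the position of a hypothesis. -/
def weight (h : Option ℕ) : ℕ := (h.map fun e => position e + 1).getD 0

theorem primrec_weight : Primrec weight := by
  have hp : Primrec position :=
    Primrec₂.natPair.comp (Primrec.encode.comp (primrec₂_comp.comp (Primrec.ofNat Code)
      (Primrec.const _))) (Primrec.const 0)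
  exact Primrec.option_getD.comp (Primrec.option_map Primrec.id
    (Primrec.succ.comp (hp.comp Primrec.snd)).to₂) (Primrec.const 0)

/-- The largest weight of the hypotheses of `M` on initial segments of `σ`. -/
def maxWeight (M : Learner) (σ : List (Option ℕ)) : ℕ :=
  Nat.rec (motive := fun _ => ℕ) 0 (fun k v => max v (weight (M (σ.take k)))) (σ.length + 1)

theorem computable_maxWeight {M : Learner} (hM : Computable M) : Computable (maxWeight M) := by
  refine Computable.nat_rec (f := fun σ : List (Option ℕ) => σ.length + 1) (g := fun _ => 0)
    (h := fun σ p => max p.2 (weight (M (σ.take p.1)))) ?_ (Computable.const 0) ?_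
  · exact Computable.succ.comp Computable.list_length
  · have h1 : Computable fun p : List (Option ℕ) × ℕ × ℕ => weight (M (p.1.take p.2.1)) :=
      primrec_weight.to_comp.comp (hM.comp
        (Primrec.list_take.comp (Primrec.fst.comp Primrec.snd) Primrec.fst).to_comp)
    exact (Primrec.nat_max.to_comp.comp (Computable.snd.comp Computable.snd) h1).to₂

theorem maxWeight_initSeg (M : Learner) (T : ℕ → Option ℕ) (s : ℕ) :
    maxWeight M (initSeg T s) = (Finset.range (s + 1)).sup fun k => weight (M (initSeg T k)) := by
  have h : ∀ n ≤ s + 1, Nat.rec (motive := fun _ => ℕ) 0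
      (fun k v => max v (weight (M ((initSeg T s).take k)))) n =
      (Finset.range n).sup fun k => weight (M (initSeg T k)) := by
    intro n hn
    induction n with
    | zero => rfl
    | succ n ih =>
      have htake : (initSeg T s).take n = initSeg T n := by
        rw [initSeg, ← List.map_take, List.take_range, min_eq_left (by omega), initSeg]
      rw [Finset.range_add_one, Finset.sup_insert, ← ih (by omega), sup_comm, ← htake]
  rw [maxWeight, initSeg_length]
  exact h _ le_rfl

theorem eventually_maxWeight_eq {M : Learner} {T : ℕ → Option ℕ}
    (hfin : {h | ∃ n, 1 ≤ n ∧ M (initSeg T n) = h}.Finite) :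
    ∃ n, (∀ j, weight (M (initSeg T j)) ≤ n) ∧ ∀ᶠ s in atTop, maxWeight M (initSeg T s) = n := by
  obtain ⟨C, hC⟩ := (hfin.image weight).bddAbove
  set w : ℕ → ℕ := fun s => maxWeight M (initSeg T s) with hw
  have hle : ∀ k s, k ≤ s → weight (M (initSeg T k)) ≤ w s := fun k s hks => by
    rw [hw]
    simp only [maxWeight_initSeg]
    exact Finset.le_sup (f := fun k => weight (M (initSeg T k)))
      (Finset.mem_range.2 (Nat.lt_succ_of_le hks))
  have hmono : Monotone w := fun s t hst => by
    simp only [hw, maxWeight_initSeg]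
    exact Finset.sup_mono (Finset.range_mono (Nat.succ_le_succ hst))
  have hbdd : BddAbove (Set.range w) := by
    -- Vacillatory learning counts hypotheses from `n = 1` on, so the one on the empty sequence is
    -- bounded separately.
    refine ⟨max C (weight (M (initSeg T 0))), ?_⟩
    rintro _ ⟨s, rfl⟩
    simp only [hw, maxWeight_initSeg]
    refine Finset.sup_le fun k _ => ?_
    rcases Nat.eq_zero_or_pos k with rfl | hk
    · exact le_max_right _ _
    · exact le_max_of_le_left (hC ⟨_, ⟨k, hk, rfl⟩, rfl⟩)
  obtain ⟨s₀, hs₀⟩ := Nat.sSup_mem (Set.range_nonempty w) hbdd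
  have heq : ∀ s ≥ s₀, w s = w s₀ := fun s hs =>
    le_antisymm (hs₀ ▸ le_csSup hbdd ⟨s, rfl⟩) (hmono hs)
  refine ⟨w s₀, fun j => ?_, eventually_atTop.2 ⟨s₀, heq⟩⟩
  exact (hle j _ (le_max_left j s₀)).trans (heq _ (le_max_right _ _)).le

theorem IsText.eventually_mem_iff {T : ℕ → Option ℕ} {L : Set ℕ} (hT : IsText T L) (x : ℕ) :
    ∀ᶠ s in atTop, (some x ∈ initSeg T s ↔ x ∈ L) := by
  have hmem : ∀ s, some x ∈ initSeg T s ↔ ∃ n < s, T n = some x := by simp [initSeg]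
  by_cases hx : x ∈ L
  · obtain ⟨n, hn⟩ := (hT ▸ hx : x ∈ {x | ∃ n, T n = some x})
    filter_upwards [eventually_gt_atTop n] with s hs
    exact iff_of_true ((hmem s).2 ⟨n, hs, hn⟩) hx
  · refine Eventually.of_forall fun s => iff_of_false (fun h => hx ?_) hx
    obtain ⟨n, -, hn⟩ := (hmem s).1 h
    exact hT ▸ ⟨n, hn⟩

/-- Here `key` is applied to `W e` itself, which need not be saturated: its closure is `L`, so it
meets exactly the classes contained in `L`. -/
theorem mem_of_isIndexOf {L : Set ℕ} {h : Option ℕ} (hh : IsIndexOf theta h L) {a b : ℕ}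
    (ha : rho a = a) (hb : rho b = b) (hab : a < b) (hw : weight h ≤ index a) (hbL : b ∈ L) :
    a ∈ L := by
  obtain ⟨e, rfl, rfl⟩ := hh
  obtain ⟨u, hu, hbu⟩ := hbL
  have hq : position e < width (index b) := by
    have h1 : position e + 1 ≤ index a := hw
    have h2 := index_lt_index ha hab
    have h3 := lt_width (index b)
    omega
  obtain ⟨v, hv, hva⟩ := key ha hb hab hq
    ⟨u, U_position e ▸ hu, (theta_iff.1 hbu).symm.trans hb⟩
  exact ⟨v, U_position e ▸ hv, theta_iff.2 (ha.trans hva.symm)⟩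

theorem exLearnable_of_vacLearnable {F : Set (Set ℕ)} (hF : IsEtaFamily theta F)
    (h : VacLearnable theta F) : ExLearnable theta F := by
  classical
  obtain ⟨M, hM, hbc, hvac⟩ := h
  obtain ⟨g, hg, hgW⟩ := exists_computable_listIndex
  refine ⟨fun σ => some (g (core σ (maxWeight M σ))), Computable.option_some.comp (hg.comp
    (primrec_core.to_comp.comp Computable.id (computable_maxWeight hM))), fun L hL T hT => ?_⟩
  have hfin := etaFinite_of_bcLearns hF hbc hL
  obtain ⟨n, hn, hev⟩ := eventually_maxWeight_eq (hvac L hL T hT)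
  obtain ⟨j, hj⟩ := hbc L hL T hT
  -- Such an `x` exists because behaviourally correct learning makes `L` ϑ-finite.
  have hex : ∃ x, rho x = x ∧ n ≤ index x ∧ x ∉ L := by
    obtain ⟨k, hk⟩ := (hfin.finite_roots.image index).bddAbove
    refine ⟨root (max n (k + 1)), rho_root _, by rw [index_root]; exact le_max_left _ _,
      fun hmem => ?_⟩
    have h1 := hk ⟨_, ⟨hmem, rho_root _⟩, rfl⟩
    rw [index_root] at h1
    have := le_max_right n (k + 1)
    omega
  set x := Nat.find hex with hx
  obtain ⟨hxr, hxn, hxL⟩ := Nat.find_spec hex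
  rw [← hx] at hxr hxn hxL
  -- A representative of `L` above `x` would pull `x` into `L`, because the weight of a correct
  -- hypothesis is at most `n ≤ index x`.
  have hbelow : ∀ b ∈ L, rho b = b → b < x := by
    intro b hbL hb
    by_contra! hxb
    rcases hxb.eq_or_lt with heq | hlt
    · exact hxL (heq ▸ hbL)
    · exact hxL (mem_of_isIndexOf (hj j le_rfl) hxr hb hlt ((hn j).trans hxn) hbL)
  have hmem : ∀ᶠ s in atTop, ∀ y ∈ Set.Iic x, (some y ∈ initSeg T s ↔ y ∈ L) :=
    (eventually_all_finite (Set.finite_Iic x)).2 fun y _ => hT.eventually_mem_iff y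
  -- The list depends only on the weight bound, the text and the representatives up to `x`, all of
  -- which settle; so the hypothesis converges syntactically.
  have hcore : ∀ᶠ s in atTop, core (initSeg T s) (maxWeight M (initSeg T s)) =
      (List.range x).filter fun y => decide (y ∈ L) := by
    filter_upwards [hev, hmem, eventually_forall_r_eq x, eventually_gt_atTop x] with s h1 h2 h3 h4
    have hcut : cut (initSeg T s) n = x := by
      rw [cut, initSeg_length, List.findIdx_eq (by simpa using h4)]
      simp only [List.getElem_range, decide_eq_true_eq, decide_eq_false_iff_not]
      refine ⟨⟨?_, ?_, ?_⟩, fun y hy hyp => Nat.find_min hex hy ?_⟩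
      · rw [h3 x le_rfl, hxr]
      · rwa [idx_eq_index fun y hy => h3 y hy.le]
      · rwa [h2 x (Set.mem_Iic.2 le_rfl)]
      · rw [h3 y hy.le, idx_eq_index fun z hz => h3 z (hz.trans hy).le,
          h2 y (Set.mem_Iic.2 hy.le)] at hyp
        exact hyp
    rw [core, h1, hcut]
    refine List.filter_congr fun y hy => ?_
    rw [decide_eq_decide]
    exact h2 y (Set.mem_Iic.2 (List.mem_range.1 hy).le)
  obtain ⟨N, hN⟩ := eventually_atTop.1 hcore
  refine ⟨N, ⟨_, rfl, ?_⟩, fun k hk => by simp only [hN k hk, hN N le_rfl]⟩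
  rw [hN N le_rfl, hgW]
  ext y
  simp only [etaClosure, Set.mem_ofPred_eq, List.mem_filter, List.mem_range, decide_eq_true_eq,
    theta_iff]
  constructor
  · rintro ⟨z, ⟨-, hz⟩, hyz⟩
    rw [← hfin.saturated y, hyz, hfin.saturated]
    exact hz
  · intro hy
    have hy' := (hfin.saturated y).2 hy
    exact ⟨rho y, ⟨hbelow _ hy' (rho_idem y), hy'⟩, (rho_idem y).symm⟩

end EtaLearning

theorem theorem6p1 :
    ∃ ϑ : Setoid ℕ, EtaLearning.IsPositive ϑ ∧
      (∀ A : Set ℕ, (EtaLearning.IsRE A ∧ EtaLearning.EtaInfinite ϑ A) ↔ A = Set.univ) ∧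
      ((∀ F : Set (Set ℕ), EtaLearning.IsEtaFamily ϑ F →
          ∃ B : ℕ → Set ℕ, StrictMono B ∧ (∀ n, B n ∈ F) ∧
            (∀ n, EtaLearning.EtaFinite ϑ (B n)) ∧ ⋃ n, B n = Set.univ) ∧
        (∀ F : Set (Set ℕ), EtaLearning.IsEtaFamily ϑ F → ¬ EtaLearning.ConfLearnable ϑ F) ∧
        (∀ F : Set (Set ℕ), EtaLearning.IsEtaFamily ϑ F → EtaLearning.BCLearnable ϑ F →
          ∀ L ∈ F, EtaLearning.EtaFinite ϑ L)) ∧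
      (∀ F : Set (Set ℕ), EtaLearning.IsEtaFamily ϑ F → EtaLearning.VacLearnable ϑ F →
        EtaLearning.ExLearnable ϑ F) := by
  refine ⟨EtaLearning.theta, EtaLearning.isPositive_theta, fun A => ⟨fun h =>
    EtaLearning.eq_univ_of_etaInfinite h.1 h.2, ?_⟩, ⟨fun F hF => hF.exists_chain, fun F hF =>
    EtaLearning.not_confLearnable hF, ?_⟩, fun F hF => EtaLearning.exLearnable_of_vacLearnable hF⟩
  · rintro rfl
    exact ⟨EtaLearning.isRE_univ, EtaLearning.etaInfinite_univ⟩
  · rintro F hF ⟨M, -, hM⟩ L hL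
    exact EtaLearning.etaFinite_of_bcLearns hF hM hL
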